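/- For a commutative ring $R$ and an integer $j\ge 0$, let $K_j^M(R)$ be the quotient of $(R^\times)^{\otimes j}$ by the subgroup generated by the elements $a_1\otimes\cdots\otimes a_j$ such that $a_l+a_m=1$ for some $1\le l<m\le j$ (so $K_0^M(R)=\mathbb Z$). Let $k$ be a commutative ring and let $j,\ell\ge 0$ be integers. Let $\operatorname{Alg}_k^{\mathrm{loc}}$ be the category of local $k$-algebras and local $k$-algebra homomorphisms, and let $$L^{\mathrm{sm}}(K_j^M/\ell):\operatorname{Alg}_k^{\mathrm{loc}}\longrightarrow D^{\le 0}(\mathbb Z)$$ be the (derived) left Kan extension of the functor $R\mapsto K_j^M(R)/\ell K_j^M(R)$ from the full subcategory of local $k$-algebras that are ind-smooth over $k$, i.e. filtered colimits of smooth $k$-algebras; its value at $A$ is the homotopy colimit of the groups $K_j^M(R)/\ell$, placed in degree $0$, over all morphisms $R\to A$ in $\operatorname{Alg}_k^{\mathrm{loc}}$ with $R$ ind-smooth over $k$. Then for every local $k$-algebra $A$ the map $$H_0\big(L^{\mathrm{sm}}(K_j^M/\ell)(A)\big)\longrightarrow K_j^M(A)/\ell$$ induced by the co-unit $L^{\mathrm{sm}}(K_j^M/\ell)\to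 K_j^M/\ell$ is an isomorphism; i.e. Milnor $K$-theory is "right exact". -/

import Mathlib

open CategoryTheory Limits Opposite AlgebraicTopology

open scoped TensorProduct

universe w v₁ v₂ v₃ u₁ u₂ u₃ u

namespace MilnorLKE

/-! ### Milnor K-theory -/

section MilnorK

/-- The subgroup of Steinberg relations in `(Rˣ)^{⊗ j}`: it is generated by the elements
`a₁ ⊗ ⋯ ⊗ a_j` such that `a_l + a_m = 1` for some `l < m`. -/
def steinberg (R : Type u) [CommRing R] (j : ℕ) :
    Submodule ℤ (⨂[ℤ] _ : Fin j, Additive Rˣ) :=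
  Submodule.span ℤ
    {t | ∃ a : Fin j → Rˣ, (∃ l m : Fin j, l < m ∧ (a l : R) + (a m : R) = 1) ∧
      t = PiTensorProduct.tprod ℤ fun i => Additive.ofMul (a i)}

/-- The `j`-th Milnor K-group of a commutative ring, written additively. -/
abbrev MilnorK (R : Type u) [CommRing R] (j : ℕ) : Type u :=
  (⨂[ℤ] _ : Fin j, Additive Rˣ) ⧸ steinberg R j

variable {R : Type u} [CommRing R] {S : Type u} [CommRing S] {T : Type u} [CommRing T]

/-- The group homomorphism `Rˣ → Sˣ` induced by a ring homomorphism, additively. -/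
def unitsMap (f : R →+* S) : Additive Rˣ →ₗ[ℤ] Additive Sˣ :=
  (MonoidHom.toAdditive (Units.map (f : R →* S))).toIntLinearMap

theorem steinberg_le_comap (f : R →+* S) (j : ℕ) :
    steinberg R j ≤ (steinberg S j).comap (PiTensorProduct.map fun _ => unitsMap f) := by
  refine Submodule.span_le.2 ?_
  rintro t ⟨a, ⟨l, m, hlm, h⟩, rfl⟩
  refine Submodule.subset_span ⟨fun i => Units.map (f : R →* S) (a i), ⟨l, m, hlm, ?_⟩, ?_⟩
  · simpa using congrArg f h
  · rw [PiTensorProduct.map_tprod]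
    rfl

/-- `{a₁, …, a_j} ↦ {f a₁, …, f a_j}`. -/
def MilnorK.map (f : R →+* S) (j : ℕ) : MilnorK R j →ₗ[ℤ] MilnorK S j :=
  Submodule.mapQ _ _ (PiTensorProduct.map fun _ => unitsMap f) (steinberg_le_comap f j)

theorem MilnorK.map_id (j : ℕ) : MilnorK.map (RingHom.id R) j = LinearMap.id := by
  apply Submodule.linearMap_qext
  apply PiTensorProduct.ext
  ext a
  simp [MilnorK.map, PiTensorProduct.map_tprod, unitsMap]

theorem MilnorK.map_comp (f : R →+* S) (g : S →+* T) (j : ℕ) :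
    MilnorK.map (g.comp f) j = MilnorK.map g j ∘ₗ MilnorK.map f j := by
  apply Submodule.linearMap_qext
  apply PiTensorProduct.ext
  ext a
  simp [MilnorK.map, PiTensorProduct.map_tprod, unitsMap]
  rfl

/-- The subgroup `ℓ M` of an abelian group `M`. -/
def multiples (M : Type u) [AddCommGroup M] (ℓ : ℕ) : Submodule ℤ M :=
  LinearMap.range ((ℓ : ℤ) • (LinearMap.id : M →ₗ[ℤ] M))

theorem multiples_le_comap {M N : Type u} [AddCommGroup M] [AddCommGroup N] (f : M →ₗ[ℤ] N)
    (ℓ : ℕ) : multiples M ℓ ≤ (multiples N ℓ).comap f := by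
  rintro _ ⟨x, rfl⟩
  exact ⟨f x, by simp⟩

variable (R) in
/-- `K_j^M(R) / ℓ`. -/
abbrev MilnorKMod (j ℓ : ℕ) : Type u :=
  MilnorK R j ⧸ multiples (MilnorK R j) ℓ

/-- Functoriality of `K_j^M(-) / ℓ`. -/
def MilnorKMod.map (f : R →+* S) (j ℓ : ℕ) : MilnorKMod R j ℓ →ₗ[ℤ] MilnorKMod S j ℓ :=
  Submodule.mapQ _ _ (MilnorK.map f j) (multiples_le_comap _ ℓ)

/-- The functor `R ↦ K_j^M(R) / ℓ` from commutative rings to abelian groups. -/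
def milnorKMod (j ℓ : ℕ) : CommRingCat.{u} ⥤ ModuleCat.{u} ℤ where
  obj R := ModuleCat.of ℤ (MilnorKMod R j ℓ)
  map f := ModuleCat.ofHom (MilnorKMod.map f.hom j ℓ)
  map_id R := by
    ext : 1
    apply Submodule.linearMap_qext
    ext x
    simp [MilnorKMod.map, MilnorK.map_id]
  map_comp f g := by
    ext : 1
    apply Submodule.linearMap_qext
    ext x
    simp [MilnorKMod.map, MilnorK.map_comp]

end MilnorK

/-! ### Local algebras and local ind-smooth algebras -/

section LocalAlgebras

/-- Local `k`-algebras. -/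
structure LocAlg (k : Type u) [CommRing k] where
  /-- The underlying type. -/
  carrier : Type u
  [commRing : CommRing carrier]
  [algebra : Algebra k carrier]
  [isLocalRing : IsLocalRing carrier]

attribute [instance] LocAlg.commRing LocAlg.algebra LocAlg.isLocalRing

variable (k : Type u) [CommRing k]

/-- The local `k`-algebra given by an unbundled one. -/
abbrev LocAlg.of (A : Type u) [CommRing A] [Algebra k A] [IsLocalRing A] : LocAlg k :=
  ⟨A⟩

/-- Morphisms of local `k`-algebras are the local `k`-algebra homomorphisms. -/
@[ext]
structure LocAlg.Hom {k : Type u} [CommRing k] (A B : LocAlg k) where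
  /-- The underlying homomorphism of `k`-algebras. -/
  hom : A.carrier →ₐ[k] B.carrier
  isLocalHom : IsLocalHom hom.toRingHom

instance : Category (LocAlg k) where
  Hom A B := LocAlg.Hom A B
  id A := ⟨AlgHom.id k A.carrier, ⟨fun _ h => h⟩⟩
  comp f g := ⟨g.hom.comp f.hom, ⟨fun a h =>
    f.isLocalHom.map_nonunit a (g.isLocalHom.map_nonunit (f.hom a) h)⟩⟩

/-- The forgetful functor from local `k`-algebras to commutative rings. -/
def LocAlg.toCommRing : LocAlg k ⥤ CommRingCat.{u} where
  obj A := CommRingCat.of A.carrier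
  map f := CommRingCat.ofHom (LocAlg.Hom.hom f).toRingHom

/-- A `k`-algebra is ind-smooth if it is a (small) filtered colimit of smooth `k`-algebras. -/
def IsIndSmooth (A : Type u) [CommRing A] [Algebra k A] : Prop :=
  ObjectProperty.ind.{u} (fun B : CommAlgCat.{u} k => Algebra.Smooth k B) (CommAlgCat.of k A)

/-- The local `k`-algebras which are ind-smooth over `k`. -/
def indSmooth : ObjectProperty (LocAlg k) :=
  fun A => IsIndSmooth k A.carrier

/-- The functor `K_j^M / ℓ` on local `k`-algebras. It takes values in abelian groups of the
universe `u + 1`, in which the (large) collection of all local `k`-algebras is small. -/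
def milnorKModLoc (j ℓ : ℕ) : LocAlg k ⥤ ModuleCat.{u + 1} ℤ :=
  LocAlg.toCommRing k ⋙ milnorKMod j ℓ ⋙ ModuleCat.uliftFunctor.{u + 1, u} ℤ

end LocalAlgebras

/-! ### Chain complexes as objects of the derived category -/

section ChainToDerived

variable {𝒜 : Type u₃} [Category.{v₃} 𝒜] [Abelian 𝒜]

theorem extendSingleIso_naturality {X Y : 𝒜} (f : X ⟶ Y) :
    HomologicalComplex.extendMap ((HomologicalComplex.single 𝒜 (ComplexShape.down ℕ) 0).map f)
        ComplexShape.embeddingDownNat ≫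
      (HomologicalComplex.extendSingleIso ComplexShape.embeddingDownNat Y 0 0 (by simp)).hom =
    (HomologicalComplex.extendSingleIso ComplexShape.embeddingDownNat X 0 0 (by simp)).hom ≫
      (HomologicalComplex.single 𝒜 (ComplexShape.up ℤ) 0).map f := by
  refine HomologicalComplex.to_single_hom_ext ?_
  rw [HomologicalComplex.comp_f, HomologicalComplex.comp_f,
    HomologicalComplex.extendMap_f _ _ (show ComplexShape.embeddingDownNat.f 0 = 0 by simp),
    HomologicalComplex.extendSingleIso_hom_f, HomologicalComplex.extendSingleIso_hom_f,
    HomologicalComplex.single_map_f_self, HomologicalComplex.single_map_f_self]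
  simp only [Category.assoc, Iso.inv_hom_id_assoc]

variable [HasDerivedCategory.{w} 𝒜]

variable (𝒜) in
/-- The functor sending a nonnegatively graded chain complex to the corresponding object of the
derived category, placed in cohomological degrees `≤ 0`. -/
noncomputable def chainToDerived : ChainComplex 𝒜 ℕ ⥤ DerivedCategory 𝒜 :=
  ComplexShape.embeddingDownNat.extendFunctor 𝒜 ⋙ DerivedCategory.Q

variable (𝒜) in
/-- An object of `𝒜` in degree zero, as an object of the derived category. -/
noncomputable def singleIso :
    ChainComplex.single₀ 𝒜 ⋙ chainToDerived 𝒜 ≅ DerivedCategory.singleFunctor 𝒜 0 :=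
  NatIso.ofComponents
      (F := ChainComplex.single₀ 𝒜 ⋙ chainToDerived 𝒜)
      (G := CochainComplex.singleFunctor 𝒜 0 ⋙ DerivedCategory.Q)
      (fun X => DerivedCategory.Q.mapIso
        (HomologicalComplex.extendSingleIso ComplexShape.embeddingDownNat X 0 0 (by simp)))
      (fun f => (DerivedCategory.Q.map_comp _ _).symm.trans
        ((congrArg DerivedCategory.Q.map (extendSingleIso_naturality f)).trans
          (DerivedCategory.Q.map_comp _ _))) ≪≫
    (DerivedCategory.singleFunctorIsoCompQ 𝒜 0).symm

end ChainToDerived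

/-! ### Derived left Kan extensions

Let `i : C ⥤ D` be a functor and let `F : C ⥤ 𝒜` be a functor to an abelian category with exact
coproducts. The left Kan extension of `F` along `i`, as a functor with values in the derived
(`∞`-)category of `𝒜`, sends `d` to the homotopy colimit of the objects `F c` over the comma
category of all `i c ⟶ d`. It is computed by the Bousfield-Kan formula (simplicial replacement): it
is represented by the complex associated to the simplicial object
`n ↦ ∐ F c₀`, the coproduct over all `c₀ ⟶ ⋯ ⟶ cₙ` in `C` together with `i cₙ ⟶ d`. -/

section LeftKanExtension

variable {C : Type u₁} [Category.{v₁} C] {D : Type u₂} [Category.{v₂} D] (i : C ⥤ D)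

/-- The `n`-simplices `c₀ ⟶ ⋯ ⟶ cₙ`, `i cₙ ⟶ d` of the nerve of the comma category of `i`
over `d`. -/
structure BarIndex (d : D) (n : SimplexCategoryᵒᵖ) where
  /-- The chain `c₀ ⟶ ⋯ ⟶ cₙ`. -/
  chain : Fin (n.unop.len + 1) ⥤ C
  /-- The structure morphism `i cₙ ⟶ d`. -/
  str : i.obj (chain.obj (Fin.last _)) ⟶ d

variable {i}

/-- The simplicial structure of the nerve of the comma category. -/
abbrev BarIndex.pull {d : D} {n m : SimplexCategoryᵒᵖ} (θ : n ⟶ m) (x : BarIndex i d n) :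
    BarIndex i d m where
  chain := θ.unop.toOrderHom.monotone.functor ⋙ x.chain
  str := i.map (x.chain.map (homOfLE (Fin.le_last _))) ≫ x.str

/-- The functoriality of the nerve of the comma category over `d` in `d`. -/
abbrev BarIndex.push {d e : D} (f : d ⟶ e) {n : SimplexCategoryᵒᵖ} (x : BarIndex i d n) :
    BarIndex i e n where
  chain := x.chain
  str := x.str ≫ f

theorem BarIndex.pull_id {d : D} {n : SimplexCategoryᵒᵖ} (x : BarIndex i d n) :
    x.pull (𝟙 n) = x := by
  obtain ⟨c, s⟩ := x
  have h : i.map (c.map (𝟙 (Fin.last n.unop.len))) ≫ s = s := by simp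
  exact congrArg (BarIndex.mk c) h

theorem BarIndex.pull_comp {d : D} {n m l : SimplexCategoryᵒᵖ} (θ : n ⟶ m) (φ : m ⟶ l)
    (x : BarIndex i d n) : x.pull (θ ≫ φ) = (x.pull θ).pull φ := by
  obtain ⟨c, s⟩ := x
  have h {p q r : Fin (n.unop.len + 1)} (f : p ⟶ q) (g : q ⟶ r) (t : i.obj (c.obj r) ⟶ d) :
      i.map (c.map (f ≫ g)) ≫ t = i.map (c.map f) ≫ i.map (c.map g) ≫ t := by simp
  exact congrArg (BarIndex.mk (i := i) (d := d) (n := l)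
    (φ.unop.toOrderHom.monotone.functor ⋙ θ.unop.toOrderHom.monotone.functor ⋙ c)) (h _ _ s)

variable {𝒜 : Type u₃} [Category.{v₃} 𝒜] [HasCoproducts.{max u₁ v₁ v₂} 𝒜]

/-- The coefficient `F c₀` at the simplex `c₀ ⟶ ⋯ ⟶ cₙ`, `i cₙ ⟶ d`. -/
abbrev BarIndex.coeff (F : C ⥤ 𝒜) {d : D} {n : SimplexCategoryᵒᵖ} (x : BarIndex i d n) : 𝒜 :=
  F.obj (x.chain.obj 0)

/-- The map of coefficients `F c₀ ⟶ F c_{θ 0}`. -/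
abbrev BarIndex.coeffMap (F : C ⥤ 𝒜) {d : D} {n m : SimplexCategoryᵒᵖ} (θ : n ⟶ m)
    (x : BarIndex i d n) : x.coeff F ⟶ (x.pull θ).coeff F :=
  F.map (x.chain.map (homOfLE (Fin.zero_le _)))

variable (i)

/-- The simplicial object `n ↦ ∐ F c₀`, the coproduct over all `c₀ ⟶ ⋯ ⟶ cₙ`, `i cₙ ⟶ d`. -/
noncomputable def barObj (F : C ⥤ 𝒜) (d : D) : SimplicialObject 𝒜 where
  obj n := ∐ fun x : BarIndex i d n => x.coeff F
  map θ := Sigma.desc fun x => x.coeffMap F θ ≫ Sigma.ι (fun y => y.coeff F) (x.pull θ)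
  map_id n := by
    refine Sigma.hom_ext _ _ fun x => ?_
    have h (y : BarIndex i d n) (hy : y = x) (f : x.coeff F ⟶ y.coeff F)
        (hf : f = eqToHom (by rw [hy])) : f ≫ Sigma.ι (fun y => y.coeff F) y =
          Sigma.ι (fun y : BarIndex i d n => y.coeff F) x := by
      subst hy
      simp [hf]
    rw [Sigma.ι_desc, Category.comp_id]
    exact h _ x.pull_id _ ((congrArg F.map (x.chain.map_id 0)).trans (F.map_id _))
  map_comp {n m l} θ φ := by
    refine Sigma.hom_ext _ _ fun x => ?_
    have h (y z : BarIndex i d l) (hy : y = z) (f : x.coeff F ⟶ y.coeff F)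
        (g : x.coeff F ⟶ z.coeff F) (hf : f ≫ eqToHom (by rw [hy]) = g) :
        f ≫ Sigma.ι (fun y => y.coeff F) y =
          g ≫ Sigma.ι (fun y : BarIndex i d l => y.coeff F) z := by
      subst hy
      simp [← hf]
    rw [Sigma.ι_desc, Sigma.ι_desc_assoc, Category.assoc, Sigma.ι_desc, ← Category.assoc]
    refine h _ _ (x.pull_comp θ φ) _ _ ?_
    have h' {p q r : Fin (n.unop.len + 1)} (f : p ⟶ q) (g : q ⟶ r) :
        F.map (x.chain.map (f ≫ g)) = F.map (x.chain.map f) ≫ F.map (x.chain.map g) := by simp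
    exact (Category.comp_id _).trans (h' _ _)

/-- The inclusion of the summand `F c₀` of a simplex. -/
noncomputable def barι (F : C ⥤ 𝒜) {d : D} {n : SimplexCategoryᵒᵖ} (x : BarIndex i d n) :
    x.coeff F ⟶ (barObj i F d).obj n :=
  Sigma.ι (fun y : BarIndex i d n => y.coeff F) x

/-- The morphism out of the `n`-simplices of `barObj` given by its components. -/
noncomputable def barDesc (F : C ⥤ 𝒜) {d : D} {n : SimplexCategoryᵒᵖ} {X : 𝒜}
    (f : ∀ x : BarIndex i d n, x.coeff F ⟶ X) : (barObj i F d).obj n ⟶ X :=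
  Sigma.desc f

theorem barι_desc (F : C ⥤ 𝒜) {d : D} {n : SimplexCategoryᵒᵖ} {X : 𝒜}
    (f : ∀ x : BarIndex i d n, x.coeff F ⟶ X) (x : BarIndex i d n) :
    barι i F x ≫ barDesc i F f = f x :=
  Sigma.ι_desc _ _

theorem barι_map (F : C ⥤ 𝒜) {d : D} {n m : SimplexCategoryᵒᵖ} (θ : n ⟶ m)
    (x : BarIndex i d n) :
    barι i F x ≫ (barObj i F d).map θ = x.coeffMap F θ ≫ barι i F (x.pull θ) :=
  Sigma.ι_desc _ _

theorem barι_desc_comp (F : C ⥤ 𝒜) {d : D} {n : SimplexCategoryᵒᵖ} {X Y : 𝒜}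
    (f : ∀ x : BarIndex i d n, x.coeff F ⟶ X) (x : BarIndex i d n) (g : X ⟶ Y) :
    barι i F x ≫ barDesc i F f ≫ g = f x ≫ g := by
  rw [← Category.assoc, barι_desc]

theorem barι_map_comp (F : C ⥤ 𝒜) {d : D} {n m : SimplexCategoryᵒᵖ} (θ : n ⟶ m)
    (x : BarIndex i d n) {Y : 𝒜} (g : (barObj i F d).obj m ⟶ Y) :
    barι i F x ≫ (barObj i F d).map θ ≫ g = x.coeffMap F θ ≫ barι i F (x.pull θ) ≫ g := by
  rw [← Category.assoc, barι_map, Category.assoc]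

theorem bar_hom_ext (F : C ⥤ 𝒜) {d : D} {n : SimplexCategoryᵒᵖ} {X : 𝒜}
    {f g : (barObj i F d).obj n ⟶ X} (h : ∀ x, barι i F x ≫ f = barι i F x ≫ g) : f = g :=
  Sigma.hom_ext _ _ h

theorem barι_congr (F : C ⥤ 𝒜) {d : D} {n : SimplexCategoryᵒᵖ} (c : Fin (n.unop.len + 1) ⥤ C)
    {s t : i.obj (c.obj (Fin.last _)) ⟶ d} (h : s = t) :
    barι i F (BarIndex.mk c s) = barι i F (BarIndex.mk c t) := by
  rw [h]

/-- The functoriality of `barObj` in `d`. -/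
noncomputable def bar (F : C ⥤ 𝒜) : D ⥤ SimplicialObject 𝒜 where
  obj d := barObj i F d
  map f :=
    { app n := barDesc i F fun x => barι i F (x.push f)
      naturality n m θ := by
        refine bar_hom_ext i F fun x => ?_
        refine (barι_map_comp i F θ x _).trans ?_
        refine (congrArg _ (barι_desc i F _ (x.pull θ))).trans ?_
        refine Eq.trans ?_ (barι_desc_comp i F _ x _).symm
        refine Eq.trans ?_ (barι_map i F θ (x.push f)).symm
        exact congrArg _ (barι_congr i F _ (Category.assoc _ _ _)) }
  map_id d := by
    ext n : 2
    refine bar_hom_ext i F fun x => ?_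
    exact (barι_desc i F _ x).trans
      ((barι_congr i F _ (Category.comp_id _)).trans (Category.comp_id _).symm)
  map_comp f g := by
    ext n : 2
    refine bar_hom_ext i F fun x => ?_
    refine (barι_desc i F _ x).trans ((barι_congr i F _ (Category.assoc _ _ _).symm).trans ?_)
    exact ((barι_desc_comp i F _ x _).trans (barι_desc i F _ (x.push f))).symm

/-- The augmentation of `barObj i (i ⋙ G) d` to `G d`: on the summand of
`c₀ ⟶ ⋯ ⟶ cₙ`, `i cₙ ⟶ d` it is the map `G (i c₀) ⟶ G d` induced by the composite. -/
noncomputable def barAugmented (G : D ⥤ 𝒜) : D ⥤ SimplicialObject.Augmented 𝒜 where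
  obj d :=
    { left := (bar i (i ⋙ G)).obj d
      right := G.obj d
      hom :=
        { app n := barDesc i (i ⋙ G) fun x =>
            G.map (i.map (x.chain.map (homOfLE (Fin.zero_le _))) ≫ x.str)
          naturality n m θ := by
            refine bar_hom_ext i _ fun x => ?_
            have h {p q r l : Fin (n.unop.len + 1)} (f : p ⟶ q) (g : q ⟶ r) (g' : r ⟶ l)
                (f' : p ⟶ l) (t : i.obj (x.chain.obj l) ⟶ d) :
                (i ⋙ G).map (x.chain.map f) ≫
                  G.map (i.map (x.chain.map g) ≫ i.map (x.chain.map g') ≫ t) =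
                G.map (i.map (x.chain.map f') ≫ t) := by
              rw [Subsingleton.elim f' (f ≫ g ≫ g')]
              simp
            refine (barι_map_comp i _ θ x _).trans ?_
            refine (congrArg _ (barι_desc i _ _ (x.pull θ))).trans ?_
            refine Eq.trans ?_ (barι_desc_comp i _ _ x _).symm
            exact (h _ _ _ _ _).trans (Category.comp_id _).symm } }
  map f :=
    { left := (bar i (i ⋙ G)).map f
      right := G.map f
      w := by
        ext n : 2
        refine bar_hom_ext i _ fun x => ?_
        refine (barι_desc_comp i _ _ x _).trans ((barι_desc i _ _ _).trans ?_)
        refine Eq.trans ?_ (barι_desc_comp i _ _ x _).symm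
        exact (congrArg G.map (Category.assoc _ _ _).symm).trans (G.map_comp _ _) }
  map_id d := by
    ext : 1
    · exact (bar i (i ⋙ G)).map_id d
    · exact G.map_id d
  map_comp f g := by
    ext : 1
    · exact (bar i (i ⋙ G)).map_comp f g
    · exact G.map_comp f g

section Derived

variable [Abelian 𝒜] [HasDerivedCategory.{w} 𝒜]

/-- The left Kan extension along `i` of a functor `F : C ⥤ 𝒜`, as a functor to the derived
category. -/
noncomputable def derivedLan (F : C ⥤ 𝒜) : D ⥤ DerivedCategory 𝒜 :=
  bar i F ⋙ alternatingFaceMapComplex 𝒜 ⋙ chainToDerived 𝒜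

/-- The co-unit `i_! i^* G ⟶ G` of the left Kan extension of the restriction along `i` of a
functor `G : D ⥤ 𝒜`. -/
noncomputable def counit (G : D ⥤ 𝒜) :
    derivedLan i (i ⋙ G) ⟶ G ⋙ DerivedCategory.singleFunctor 𝒜 0 :=
  Functor.whiskerLeft (barAugmented i G)
    (Functor.whiskerRight AlternatingFaceMapComplex.ε (chainToDerived 𝒜)) ≫
      Functor.whiskerLeft G (singleIso 𝒜).hom

/-- The map `H₀(i_! i^* G) ⟶ G` induced by the co-unit. -/
noncomputable def counitH₀ (G : D ⥤ 𝒜) :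
    derivedLan i (i ⋙ G) ⋙ DerivedCategory.homologyFunctor 𝒜 0 ⟶ G :=
  Functor.whiskerRight (counit i G) (DerivedCategory.homologyFunctor 𝒜 0) ≫
    Functor.whiskerLeft G (DerivedCategory.singleFunctorCompHomologyFunctorIso 𝒜 0).hom

end Derived

end LeftKanExtension

/-! ### The left Kan extension of Milnor K-theory -/

section Main

variable (k : Type u) [CommRing k] (j ℓ : ℕ) [HasDerivedCategory.{w} (ModuleCat.{u + 1} ℤ)]

/-- `L^sm (K_j^M / ℓ)`: the left Kan extension of `K_j^M / ℓ` from local ind-smooth `k`-algebras to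
all local `k`-algebras. -/
noncomputable def Lsm : LocAlg k ⥤ DerivedCategory (ModuleCat.{u + 1} ℤ) :=
  derivedLan (indSmooth k).ι ((indSmooth k).ι ⋙ milnorKModLoc k j ℓ)

/-- The map `H₀(L^sm (K_j^M / ℓ)(A)) ⟶ K_j^M(A) / ℓ` induced by the co-unit. -/
noncomputable def LsmCounitH₀ (A : LocAlg k) :
    (DerivedCategory.homologyFunctor (ModuleCat.{u + 1} ℤ) 0).obj ((Lsm k j ℓ).obj A) ⟶
      (milnorKModLoc k j ℓ).obj A :=
  (counitH₀ (indSmooth k).ι (milnorKModLoc k j ℓ)).app A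

end Main

end MilnorLKE

namespace MilnorLKE

/-! ### Degree-zero homology of the bar construction as a colimit -/

section CounitIso

/-! Only simplices of dimension 0 and 1 affect `H₀`: for the bar construction it is the cokernel of
`d 1 0`, that is, the ordinary colimit of the objects `G (i c)` over all `i c ⟶ d`. Hence it
suffices that `K_j^M(A)/ℓ` has the universal property of this colimit (`isIso_counitH₀_app`).

A finite tuple `a` of units of `A` is a point of an affine space over `k`. The local ring `P` of
affine space at this point is ind-smooth, and its coordinates form a universal lift of `a`: they map
to any other lift by a local map over `A` (`exists_universal_lift`). A compatible family of maps
therefore takes the same value on the symbols of all lifts of `a`, which defines a function of `a`.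

This function respects the relations of `K_j^M(A)/ℓ` because they lift. For multiplicativity all
entries are lifted to one ring. For `a_l + a_m = 1`, a lift `y_l` is kept and `1 - y_l` is used to
lift `a_m`; it is a unit since `P ⟶ A` is local (`exists_milnorKMod_desc`). Uniqueness holds because
every symbol lifts (`milnorKMod_desc_unique`). Filteredness of the comma category plays no role. -/

theorem isIso_homologyFunctor_map_chainToDerived {𝒜 : Type u₃} [Category.{v₃} 𝒜] [Abelian 𝒜]
    [HasDerivedCategory.{w} 𝒜] {K L : ChainComplex 𝒜 ℕ} (f : K ⟶ L) [QuasiIsoAt f 0] :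
    IsIso ((DerivedCategory.homologyFunctor 𝒜 0).map ((chainToDerived 𝒜).map f)) := by
  have h : QuasiIsoAt (HomologicalComplex.extendMap f ComplexShape.embeddingDownNat) 0 :=
    (HomologicalComplex.quasiIsoAt_extendMap_iff f ComplexShape.embeddingDownNat
      (j := 0) (j' := 0) (by simp)).2 inferInstance
  rw [quasiIsoAt_iff_isIso_homologyMap] at h
  exact ((MorphismProperty.isomorphisms 𝒜).arrow_mk_iso_iff
    (Arrow.isoMk ((DerivedCategory.homologyFunctorFactors 𝒜 0).app _)
      ((DerivedCategory.homologyFunctorFactors 𝒜 0).app _)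
      (DerivedCategory.homologyFunctorFactors_hom_naturality
        (HomologicalComplex.extendMap f ComplexShape.embeddingDownNat) 0).symm)).2 h

/-- No differential leaves degree 0 and those of the target vanish, so an isomorphism on `H₀`
amounts to exactness of `K₁ ⟶ K₀ ⟶ Y ⟶ 0`. -/
theorem quasiIsoAt_zero_of_isColimit {𝒜 : Type u₃} [Category.{v₃} 𝒜] [Abelian 𝒜]
    {K : ChainComplex 𝒜 ℕ} {Y : 𝒜} (f : K ⟶ (ChainComplex.single₀ 𝒜).obj Y)
    (w : K.d 1 0 ≫ f.f 0 = 0) (h : IsColimit (CokernelCofork.ofπ (f := K.d 1 0) (f.f 0) w)) :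
    QuasiIsoAt f 0 := by
  rw [ChainComplex.quasiIsoAt₀_iff, ShortComplex.quasiIso_iff_of_zeros']
  · exact (ShortComplex.exact_and_epi_g_iff_g_is_cokernel _).2 ⟨h⟩
  · exact HomologicalComplex.shape _ _ _ (by simp)
  · exact HomologicalComplex.single_obj_d (ComplexShape.down ℕ) _ _ _ _
  · exact HomologicalComplex.single_obj_d (ComplexShape.down ℕ) _ _ _ _

/-- A functor out of `Fin 1` is constant. -/
theorem eq_const_of_fin_one {C : Type u₁} [Category.{v₁} C] (x : Fin 1 ⥤ C) :
    x = (Functor.const _).obj (x.obj 0) := by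
  refine CategoryTheory.Functor.ext (fun i => congrArg x.obj (Subsingleton.elim _ _)) fun i j f => ?_
  obtain rfl : i = 0 := Subsingleton.elim _ _
  obtain rfl : j = 0 := Subsingleton.elim _ _
  obtain rfl : f = 𝟙 _ := Subsingleton.elim _ _
  simp

variable {C : Type u₁} [Category.{v₁} C] {D : Type u₂} [Category.{v₂} D] (i : C ⥤ D)
  {𝒜 : Type u₃} [Category.{v₃} 𝒜] [HasCoproducts.{max u₁ v₁ v₂} 𝒜]

/-- The vertex of the nerve of the comma category given by an object of the latter. -/
abbrev BarIndex.vertex {d : D} (c : C) (s : i.obj c ⟶ d) : BarIndex i d (op (SimplexCategory.mk 0)) where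
  chain := (Functor.const (Fin 1)).obj c
  str := s

/-- The edge of the nerve of the comma category given by a morphism of the latter. -/
abbrev BarIndex.edge {d : D} {c c' : C} (f : c ⟶ c') (s : i.obj c' ⟶ d) :
    BarIndex i d (op (SimplexCategory.mk 1)) where
  chain := ComposableArrows.mk₁ f
  str := s

/-- The faces of an edge are chains obtained by precomposition, which are not constant functors by
definition; this lets them be replaced by standard vertices. -/
theorem barι_vertex (F : C ⥤ 𝒜) {d : D} (x : BarIndex i d (op (SimplexCategory.mk 0))) :
    barι i F x = barι i F (BarIndex.vertex i (x.chain.obj 0) x.str) := by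
  -- Stated for variable functors so that their equality can be eliminated; the transports that
  -- remain are along reflexivity and disappear.
  have key (p q : Fin 1 ⥤ C) (h : p = q) (s : i.obj (p.obj 0) ⟶ d) (t : i.obj (q.obj 0) ⟶ d)
      (hs : s = i.map (eqToHom (by rw [h])) ≫ t) :
      barι i F (BarIndex.mk (n := op (SimplexCategory.mk 0)) p s) =
        F.map (eqToHom (by subst h; rfl)) ≫
          barι i F (BarIndex.mk (n := op (SimplexCategory.mk 0)) q t) := by
    subst h
    simp at hs
    subst hs
    exact (Category.id_comp _).symm.trans (by rw [eqToHom_refl, F.map_id])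
  refine (key x.chain _ (eq_const_of_fin_one x.chain) x.str x.str ?_).trans ?_
  · exact (Category.id_comp _).symm.trans (by rw [eqToHom_refl, i.map_id]; rfl)
  · refine Eq.trans ?_ (Category.id_comp _)
    rw [eqToHom_refl, F.map_id]

variable [Abelian 𝒜]

/-- Here `d 1 0` is `δ₀ - δ₁`. On the summand of the edge `f`, `δ₀` drops `c` and moves the
coefficient along `F.map f`, while `δ₁` drops `c'` and composes the structure map with `i.map f`. A
map killing the differential is thus a compatible family on vertices. -/
theorem barι_edge_d (F : C ⥤ 𝒜) {d : D} {c c' : C} (f : c ⟶ c') (s : i.obj c' ⟶ d) {Z : 𝒜}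
    (g : (barObj i F d).obj (op (SimplexCategory.mk 0)) ⟶ Z)
    (hg : ((alternatingFaceMapComplex 𝒜).obj (barObj i F d)).d 1 0 ≫ g = 0) :
    F.map f ≫ barι i F (BarIndex.vertex i c' s) ≫ g =
      barι i F (BarIndex.vertex i c (i.map f ≫ s)) ≫ g := by
  have h : (barObj i F d).map (SimplexCategory.δ (0 : Fin 2)).op ≫ g =
      (barObj i F d).map (SimplexCategory.δ (1 : Fin 2)).op ≫ g := by
    have e := AlternatingFaceMapComplex.obj_d_eq (barObj i F d) 0
    rw [Fin.sum_univ_two] at e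
    have h' := (congrArg (· ≫ g) e).symm.trans hg
    simp only [Fin.val_zero, Fin.val_one, pow_zero, pow_one, one_smul, neg_smul,
      Preadditive.add_comp, Preadditive.neg_comp] at h'
    exact add_neg_eq_zero.1 h'
  have h := congrArg (barι i F (BarIndex.edge i f s) ≫ ·) h
  have h := (barι_map_comp i F _ (BarIndex.edge i f s) g).symm.trans
    (h.trans (barι_map_comp i F _ (BarIndex.edge i f s) g))
  rw [barι_vertex i F (BarIndex.pull _ _), barι_vertex i F (BarIndex.pull _ _)] at h
  have e₀ : i.map (𝟙 c') ≫ s = s := by simp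
  have e₁ (t) : F.map (𝟙 c) ≫ t = (t : F.obj c ⟶ Z) := by simp
  refine Eq.trans ?_ (h.trans ?_)
  · exact congrArg (fun t => F.map f ≫ barι i F (BarIndex.vertex i c' t) ≫ g) e₀.symm
  · exact e₁ _

variable [HasDerivedCategory.{w} 𝒜]

/-- The map `H₀(i_! i^* G)(d) ⟶ G d` is an isomorphism as soon as `G d` is the colimit of the
objects `G (i c)` over all `i c ⟶ d`. -/
theorem isIso_counitH₀_app (G : D ⥤ 𝒜) (d : D)
    (desc : ∀ (Z : 𝒜) (φ : ∀ (c : C) (_ : i.obj c ⟶ d), G.obj (i.obj c) ⟶ Z)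
      (_ : ∀ (c c' : C) (f : c ⟶ c') (s : i.obj c' ⟶ d),
        G.map (i.map f) ≫ φ c' s = φ c (i.map f ≫ s)),
      ∃ ψ : G.obj d ⟶ Z, ∀ (c : C) (s : i.obj c ⟶ d), G.map s ≫ ψ = φ c s)
    (ext : ∀ (Z : 𝒜) (ψ ψ' : G.obj d ⟶ Z)
      (_ : ∀ (c : C) (s : i.obj c ⟶ d), G.map s ≫ ψ = G.map s ≫ ψ'), ψ = ψ') :
    IsIso ((counitH₀ i G).app d) := by
  let X := (barAugmented i G).obj d
  let f := AlternatingFaceMapComplex.ε.app X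
  have hf : f.f 0 = barDesc i (i ⋙ G) fun x =>
      G.map (i.map (x.chain.map (homOfLE (Fin.zero_le _))) ≫ x.str) :=
    AlternatingFaceMapComplex.ε_app_f_zero X
  have hι (c : C) (s : i.obj c ⟶ d) :
      barι i (i ⋙ G) (BarIndex.vertex i c s) ≫ f.f 0 = G.map s := by
    rw [hf]
    refine (barι_desc i (i ⋙ G) _ _).trans ?_
    have : i.map (𝟙 c) ≫ s = s := by simp
    exact congrArg G.map this
  have : QuasiIsoAt f 0 := by
    refine quasiIsoAt_zero_of_isColimit f ?_ ?_
    · refine (f.comm 1 0).symm.trans ((congrArg _ ?_).trans comp_zero)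
      exact HomologicalComplex.single_obj_d _ _ _ _ _
    · have H (Z : 𝒜) (g : (barObj i (i ⋙ G) d).obj (op (SimplexCategory.mk 0)) ⟶ Z)
          (hg : ((alternatingFaceMapComplex 𝒜).obj (barObj i (i ⋙ G) d)).d 1 0 ≫ g = 0) :=
        desc Z (fun c s => barι i (i ⋙ G) (BarIndex.vertex i c s) ≫ g)
          (fun c c' φ s => barι_edge_d i (i ⋙ G) φ s g hg)
      refine CokernelCofork.IsColimit.ofπ _ _ (fun {Z} g hg => (H Z g hg).choose)
        (fun {Z} g hg => ?_) (fun {Z} g hg m hm => ?_)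
      · refine bar_hom_ext i (i ⋙ G) fun x => ?_
        rw [barι_vertex]
        refine (Category.assoc _ _ _).symm.trans ?_
        refine Eq.trans ?_ ((H Z g hg).choose_spec _ _)
        exact congrArg (· ≫ _) (hι _ _)
      · refine ext Z _ _ fun c s => ((H Z g hg).choose_spec c s).symm ▸ ?_
        rw [← hm, ← hι c s]
        exact Category.assoc _ _ _
  -- The co-unit is `f` followed by the identification `singleIso`, so only `f` has to be inverted
  -- on `H₀`.
  have := isIso_homologyFunctor_map_chainToDerived f
  have h₁ : IsIso ((DerivedCategory.homologyFunctor 𝒜 0).map ((counit i G).app d)) := by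
    refine (congrArg _ ((DerivedCategory.homologyFunctor 𝒜 0).map_comp
      ((chainToDerived 𝒜).map f) ((singleIso 𝒜).hom.app (G.obj d)))).mpr ?_
    exact IsIso.comp_isIso' this (inferInstanceAs (IsIso
      ((DerivedCategory.homologyFunctor 𝒜 0).map ((singleIso 𝒜).hom.app (G.obj d)))))
  exact IsIso.comp_isIso' h₁ (f := (DerivedCategory.homologyFunctor 𝒜 0).map ((counit i G).app d))
    (inferInstanceAs (IsIso
      ((DerivedCategory.singleFunctorCompHomologyFunctorIso 𝒜 0).hom.app (G.obj d))))

end CounitIso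

end MilnorLKE

namespace MilnorLKE

/-! ### Localizations of smooth algebras are ind-smooth -/

section IndSmooth

variable {k : Type u} [CommRing k]

/-- A submonoid, preordered by divisibility in the ambient monoid. -/
structure DvdPreorder {P : Type u} [CommRing P] (M : Submonoid P) : Type u where
  /-- The underlying element. -/
  val : M

namespace DvdPreorder

section

variable {P : Type u} [CommRing P] (M : Submonoid P)

instance : Preorder (DvdPreorder M) where
  le x y := (x.val : P) ∣ (y.val : P)
  le_refl x := dvd_refl (x.val : P)
  le_trans _ _ _ := dvd_trans

instance : Nonempty (DvdPreorder M) := ⟨⟨1⟩⟩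

instance : IsDirectedOrder (DvdPreorder M) where
  directed x y := ⟨⟨x.val * y.val⟩, Dvd.intro (y.val : P) rfl, Dvd.intro_left (x.val : P) rfl⟩

end

variable {P : Type u} [CommRing P] [Algebra k P] (M : Submonoid P)

/-- The homomorphism from the localization away from an element to an algebra in which this element
is invertible. -/
noncomputable def awayLift {B : Type u} [CommRing B] [Algebra k B] (x : P) (f : P →ₐ[k] B)
    (hx : IsUnit (f x)) : Localization.Away x →ₐ[k] B :=
  IsLocalization.liftAlgHom (M := Submonoid.powers x) (f := f) (by
    rintro ⟨_, n, rfl⟩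
    simpa using hx.pow n)

theorem awayLift_algebraMap {B : Type u} [CommRing B] [Algebra k B] (x : P) (f : P →ₐ[k] B)
    (hx : IsUnit (f x)) (p : P) :
    awayLift x f hx (algebraMap P (Localization.Away x) p) = f p :=
  IsLocalization.lift_eq (M := Submonoid.powers x) _ p

theorem away_algHom_ext {B : Type u} [CommRing B] [Algebra k B] {x : P}
    {f g : Localization.Away x →ₐ[k] B}
    (h : ∀ p, f (algebraMap P _ p) = g (algebraMap P _ p)) : f = g :=
  IsLocalization.algHom_ext (Submonoid.powers x) (AlgHom.ext h)

theorem isUnit_away_of_le {x y : DvdPreorder M} (h : x ≤ y) :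
    IsUnit (IsScalarTower.toAlgHom k P (Localization.Away (y.val : P)) (x.val : P)) :=
  isUnit_of_dvd_unit (map_dvd _ h)
    (IsLocalization.Away.algebraMap_isUnit (S := Localization.Away (y.val : P)) (y.val : P))

variable (k) in
/-- The transition map between localizations away from elements. -/
noncomputable def awayMap {x y : DvdPreorder M} (h : x ≤ y) :
    Localization.Away (x.val : P) →ₐ[k] Localization.Away (y.val : P) :=
  awayLift _ (IsScalarTower.toAlgHom k P _) (isUnit_away_of_le M h)

theorem awayMap_algebraMap {x y : DvdPreorder M} (h : x ≤ y) (p : P) :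
    awayMap k M h (algebraMap P _ p) = algebraMap P _ p :=
  awayLift_algebraMap _ _ _ p

variable (k) in
/-- The map from the localization away from an element of a submonoid to the localization at the
submonoid. -/
noncomputable def awayToLocalization (x : DvdPreorder M) :
    Localization.Away (x.val : P) →ₐ[k] Localization M :=
  awayLift _ (IsScalarTower.toAlgHom k P _) (IsLocalization.map_units (Localization M) x.val)

theorem awayToLocalization_algebraMap (x : DvdPreorder M) (p : P) :
    awayToLocalization k M x (algebraMap P _ p) = algebraMap P _ p :=
  awayLift_algebraMap _ _ _ p

variable (k) in
/-- The localizations away from the elements of a submonoid. -/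
noncomputable def away : DvdPreorder M ⥤ CommAlgCat.{u} k where
  obj x := CommAlgCat.of k (Localization.Away (x.val : P))
  map f := CommAlgCat.ofHom (awayMap k M f.le)
  map_id x := by
    ext : 1
    exact away_algHom_ext fun p => awayMap_algebraMap M (le_refl x) p
  map_comp {x y z} f g := by
    ext : 1
    refine away_algHom_ext fun p => (awayMap_algebraMap M (f ≫ g).le p).trans ?_
    change _ = awayMap k M g.le (awayMap k M f.le (algebraMap P _ p))
    rw [awayMap_algebraMap, awayMap_algebraMap]

variable (k) in
/-- The localization at a submonoid as a cocone over the localizations away from its elements. -/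
noncomputable def awayCocone : Cocone (away k M) where
  pt := CommAlgCat.of k (Localization M)
  ι :=
    { app x := CommAlgCat.ofHom (awayToLocalization k M x)
      naturality x y f := by
        ext : 1
        refine away_algHom_ext fun p => ?_
        change awayToLocalization k M y (awayMap k M f.le (algebraMap P _ p)) =
          awayToLocalization k M x (algebraMap P _ p)
        rw [awayMap_algebraMap, awayToLocalization_algebraMap, awayToLocalization_algebraMap] }

variable {M} in
-- Since 1 divides everything, it is a least element of the index, so its leg determines all legs on
-- the image of `P`.
theorem cocone_algebraMap_eq (s : Cocone (away k M)) (x : DvdPreorder M) (p : P) :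
    (s.ι.app x).hom (algebraMap P (Localization.Away (x.val : P)) p) =
      (s.ι.app ⟨1⟩).hom (algebraMap P (Localization.Away ((1 : M) : P)) p) := by
  have h : (⟨1⟩ : DvdPreorder M) ≤ x := one_dvd (x.val : P)
  have e := congrArg (fun f => f.hom (algebraMap P (Localization.Away ((1 : M) : P)) p))
    (s.w (homOfLE h))
  exact (congrArg (s.ι.app x).hom (awayMap_algebraMap (k := k) M h p).symm).trans e

/-- The map out of the localization at a submonoid given by a cocone over the localizations away
from its elements. -/
noncomputable def awayCoconeDesc (s : Cocone (away k M)) : Localization M →ₐ[k] s.pt :=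
  IsLocalization.liftAlgHom (M := M) (S := Localization M)
    (f := (s.ι.app ⟨1⟩).hom.comp
      (IsScalarTower.toAlgHom k P (Localization.Away ((1 : M) : P)))) (fun y => by
        -- The element `y` is already invertible at stage `y`, and its image in the cocone point
        -- does not depend on the stage.
        refine (congrArg IsUnit (cocone_algebraMap_eq s ⟨y⟩ (y : P))).mp ?_
        exact (IsLocalization.Away.algebraMap_isUnit
          (S := Localization.Away (y : P)) (y : P)).map _)

theorem awayCoconeDesc_algebraMap (s : Cocone (away k M)) (p : P) :
    awayCoconeDesc M s (algebraMap P _ p) =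
      (s.ι.app ⟨1⟩).hom (algebraMap P (Localization.Away ((1 : M) : P)) p) :=
  IsLocalization.lift_eq _ _

variable (k) in
/-- The localization at a submonoid is the filtered colimit of the localizations away from its
elements. -/
noncomputable def awayCoconeIsColimit : IsColimit (awayCocone k M) where
  desc s := CommAlgCat.ofHom (awayCoconeDesc M s)
  fac s x := by
    ext : 1
    refine away_algHom_ext fun p => ?_
    change awayCoconeDesc M s (awayToLocalization k M x (algebraMap P _ p)) = _
    rw [awayToLocalization_algebraMap, awayCoconeDesc_algebraMap]
    exact (cocone_algebraMap_eq s x p).symm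
  uniq s m hm := by
    ext : 1
    let m' : Localization M →ₐ[k] s.pt := m.hom
    change m' = awayCoconeDesc M s
    refine IsLocalization.algHom_ext M (AlgHom.ext fun p => ?_)
    refine Eq.trans ?_ (awayCoconeDesc_algebraMap M s p).symm
    rw [← hm ⟨1⟩]
    exact congrArg m.hom (awayToLocalization_algebraMap (k := k) M ⟨1⟩ p).symm

end DvdPreorder

/-- The localizations of a smooth algebra are ind-smooth. -/
theorem isIndSmooth_localization {P : Type u} [CommRing P] [Algebra k P] [Algebra.Smooth k P]
    (M : Submonoid P) : IsIndSmooth k (Localization M) := by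
  refine ⟨DvdPreorder M, inferInstance, inferInstance,
    ⟨DvdPreorder.away k M, _, DvdPreorder.awayCoconeIsColimit k M⟩, fun x => ?_⟩
  have := Algebra.Smooth.of_isLocalization_Away (A := Localization.Away (x.val : P)) (x.val : P)
  exact Algebra.Smooth.comp k P (Localization.Away (x.val : P))

end IndSmooth

/-! ### Local rings of affine space at a point with values in a local algebra -/

section FreeLocal

variable {k : Type u} [CommRing k] {σ : Type u}

/-- The ideal of polynomials whose value at a given point of a local algebra is not a unit. -/
noncomputable abbrev pointIdeal (A : LocAlg k) (v : σ → A.carrier) : Ideal (MvPolynomial σ k) :=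
  (IsLocalRing.maximalIdeal A.carrier).comap (MvPolynomial.aeval (R := k) v)

theorem mem_primeCompl_pointIdeal (A : LocAlg k) (v : σ → A.carrier) (p : MvPolynomial σ k) :
    p ∈ (pointIdeal A v).primeCompl ↔ IsUnit (MvPolynomial.aeval (R := k) v p) := by
  change ¬ (MvPolynomial.aeval (R := k) v p ∈ IsLocalRing.maximalIdeal A.carrier) ↔ _
  simp

/-- The local ring of affine space at a point with values in a local algebra. -/
noncomputable def freeLocal (A : LocAlg k) (v : σ → A.carrier) : LocAlg k :=
  LocAlg.of k (Localization.AtPrime (pointIdeal A v))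

theorem freeLocal_indSmooth [Finite σ] (A : LocAlg k) (v : σ → A.carrier) :
    indSmooth k (freeLocal A v) := by
  have : Algebra.Smooth k (MvPolynomial σ k) := {}
  exact isIndSmooth_localization _

/-- The coordinates. -/
noncomputable def freeLocal.X (A : LocAlg k) (v : σ → A.carrier) (t : σ) :
    (freeLocal A v).carrier :=
  algebraMap (MvPolynomial σ k) (Localization.AtPrime (pointIdeal A v)) (MvPolynomial.X t)

/-- The morphism out of `freeLocal` given by the images of the coordinates. -/
theorem exists_freeLocal_hom {A R : LocAlg k} (v : σ → A.carrier) (s : R ⟶ A)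
    (x : σ → R.carrier) (hx : ∀ t, s.hom (x t) = v t) :
    ∃ f : freeLocal A v ⟶ R, ∀ t, f.hom (freeLocal.X A v t) = x t := by
  have e (p : MvPolynomial σ k) :
      s.hom (MvPolynomial.aeval (R := k) x p) = MvPolynomial.aeval (R := k) v p := by
    have : s.hom.comp (MvPolynomial.aeval (R := k) x) = MvPolynomial.aeval (R := k) v := by
      ext t
      simp [hx]
    exact DFunLike.congr_fun this p
  -- As `s` is local, the same polynomials become units in `R` and in `A`. One direction extends
  -- evaluation at `x` to the localization, the other makes the extension local.
  have hu (p : MvPolynomial σ k) :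
      p ∈ (pointIdeal A v).primeCompl ↔ IsUnit (MvPolynomial.aeval (R := k) x p) := by
    rw [mem_primeCompl_pointIdeal, ← e]
    exact ⟨fun h => s.isLocalHom.map_nonunit _ h, fun h => h.map s.hom⟩
  let f : Localization.AtPrime (pointIdeal A v) →ₐ[k] R.carrier :=
    IsLocalization.liftAlgHom (M := (pointIdeal A v).primeCompl)
      (f := MvPolynomial.aeval (R := k) x) fun y => (hu y).1 y.2
  have hf (p) : f (algebraMap _ _ p) = MvPolynomial.aeval (R := k) x p :=
    IsLocalization.lift_eq _ p
  refine ⟨⟨f, ⟨fun z hz => ?_⟩⟩, fun t => (hf _).trans (MvPolynomial.aeval_X _ _)⟩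
  -- For `z = p / y` with `f z` a unit, `f p = f z * f y` is a unit, so `p` lies outside the prime
  -- and `z` is a unit.
  obtain ⟨p, y, rfl⟩ := IsLocalization.exists_mk'_eq (S := Localization.AtPrime (pointIdeal A v))
    (pointIdeal A v).primeCompl z
  refine (IsLocalization.AtPrime.isUnit_mk'_iff (Localization.AtPrime (pointIdeal A v))
    (pointIdeal A v) p y).2 ((hu p).2 ?_)
  rw [← hf, ← IsLocalization.mk'_spec (Localization.AtPrime (pointIdeal A v)) p y, map_mul]
  exact IsUnit.mul hz ((hf _).symm ▸ (hu y).1 y.2)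

theorem freeLocal_hom_ext {A R : LocAlg k} {v : σ → A.carrier} {f g : freeLocal A v ⟶ R}
    (h : ∀ t, f.hom (freeLocal.X A v t) = g.hom (freeLocal.X A v t)) : f = g := by
  let f' : Localization.AtPrime (pointIdeal A v) →ₐ[k] R.carrier := f.hom
  let g' : Localization.AtPrime (pointIdeal A v) →ₐ[k] R.carrier := g.hom
  have e : f' = g' :=
    IsLocalization.algHom_ext (pointIdeal A v).primeCompl (MvPolynomial.algHom_ext h)
  exact LocAlg.Hom.ext e

/-- The map from `freeLocal` to the local algebra given by the point. -/
noncomputable def freeLocal.point (A : LocAlg k) (v : σ → A.carrier) : freeLocal A v ⟶ A :=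
  (exists_freeLocal_hom v (𝟙 A) v fun _ => rfl).choose

theorem freeLocal.point_X (A : LocAlg k) (v : σ → A.carrier) (t : σ) :
    (freeLocal.point A v).hom (freeLocal.X A v t) = v t :=
  (exists_freeLocal_hom v (𝟙 A) v fun _ => rfl).choose_spec t

end FreeLocal

end MilnorLKE

namespace MilnorLKE

/-! ### Symbols and the universal property of Milnor K-theory modulo `ℓ` -/

section Symbols

variable {R S : Type u} [CommRing R] [CommRing S] {j ℓ : ℕ}

/-- The class of the symbol `{a₁, …, a_j}` modulo `ℓ`. -/
def symbol (ℓ : ℕ) (a : Fin j → Rˣ) : MilnorKMod R j ℓ :=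
  Submodule.Quotient.mk
    (Submodule.Quotient.mk (PiTensorProduct.tprod ℤ fun i => Additive.ofMul (a i)))

theorem map_symbol (f : R →+* S) (a : Fin j → Rˣ) :
    MilnorKMod.map f j ℓ (symbol ℓ a) = symbol ℓ fun i => Units.map (f : R →* S) (a i) := by
  change Submodule.Quotient.mk (Submodule.Quotient.mk
    (PiTensorProduct.map (fun _ => unitsMap f) (PiTensorProduct.tprod ℤ _))) = _
  rw [PiTensorProduct.map_tprod]
  rfl

theorem milnorKMod_hom_ext {M : Type*} [AddCommGroup M] [Module ℤ M] {f g : MilnorKMod R j ℓ →ₗ[ℤ] M}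
    (h : ∀ a : Fin j → Rˣ, f (symbol ℓ a) = g (symbol ℓ a)) : f = g := by
  apply Submodule.linearMap_qext
  apply Submodule.linearMap_qext
  apply PiTensorProduct.ext
  ext a
  exact h fun i => (a i).toMul

theorem symbol_update_mul (a : Fin j → Rˣ) (i : Fin j) (b c : Rˣ) :
    symbol ℓ (Function.update a i (b * c)) =
      symbol ℓ (Function.update a i b) + symbol ℓ (Function.update a i c) := by
  have h (b : Rˣ) : (fun t => Additive.ofMul (Function.update a i b t)) =
      Function.update (fun t => Additive.ofMul (a t)) i (Additive.ofMul b) := by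
    ext t
    by_cases ht : t = i
    · subst ht
      simp
    · simp [ht]
  simp only [symbol, h, ofMul_mul, MultilinearMap.map_update_add]
  rfl

theorem symbol_eq_zero (a : Fin j → Rˣ) {l m : Fin j} (hlm : l < m)
    (h : (a l : R) + (a m : R) = 1) : symbol ℓ a = 0 := by
  have : (Submodule.Quotient.mk (PiTensorProduct.tprod ℤ fun i => Additive.ofMul (a i)) :
      MilnorK R j) = 0 :=
    (Submodule.Quotient.mk_eq_zero _).2 (Submodule.subset_span ⟨a, ⟨l, m, hlm, h⟩, rfl⟩)
  rw [symbol, this]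
  rfl

theorem smul_symbol (a : Fin j → Rˣ) : (ℓ : ℤ) • symbol ℓ a = 0 :=
  (Submodule.Quotient.mk_eq_zero _).2 ⟨_, rfl⟩

/-- The universal property of `K_j^M / ℓ`. -/
theorem exists_milnorKMod_lift {M : Type*} [AddCommGroup M] [Module ℤ M] (Φ : (Fin j → Rˣ) → M)
    (mul : ∀ a i b c, Φ (Function.update a i (b * c)) =
      Φ (Function.update a i b) + Φ (Function.update a i c))
    (steinberg_zero : ∀ (a : Fin j → Rˣ) (l m : Fin j), l < m → (a l : R) + (a m : R) = 1 → Φ a = 0)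
    (smul_zero : ∀ a, (ℓ : ℤ) • Φ a = 0) :
    ∃ ψ : MilnorKMod R j ℓ →ₗ[ℤ] M, ∀ a, ψ (symbol ℓ a) = Φ a := by
  -- A `ℤ`-module structure is unique; the canonical one makes additive maps linear through
  -- `map_zsmul`.
  obtain rfl := Subsingleton.elim ‹Module ℤ M› (AddCommGroup.toIntModule M)
  let Ψ (a : Fin j → Additive Rˣ) : M := Φ fun i => (a i).toMul
  have hΨ (a : Fin j → Additive Rˣ) (i : Fin j) (b c : Additive Rˣ) :
      Ψ (Function.update a i (b + c)) = Ψ (Function.update a i b) + Ψ (Function.update a i c) :=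
    mul a i b c
  let f : MultilinearMap ℤ (fun _ : Fin j => Additive Rˣ) M :=
    { toFun := Ψ
      map_update_add' := fun {inst} a i b c => by
        rw [Subsingleton.elim inst (instDecidableEqFin j)]
        exact hΨ a i b c
      map_update_smul' := fun {inst} a i n b => by
        obtain rfl := Subsingleton.elim inst (instDecidableEqFin j)
        exact map_zsmul (AddMonoidHom.mk' (fun b => Ψ (Function.update a i b)) (hΨ a i)) n b }
  let g : MilnorK R j →ₗ[ℤ] M := (steinberg R j).liftQ (PiTensorProduct.lift f) (by
    refine Submodule.span_le.2 ?_
    rintro t ⟨a, ⟨l, m, hlm, h⟩, rfl⟩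
    exact (PiTensorProduct.lift.tprod _).trans (steinberg_zero a l m hlm h))
  have hg (a : Fin j → Rˣ) : g (Submodule.Quotient.mk
      (PiTensorProduct.tprod ℤ fun i => Additive.ofMul (a i))) = Φ a :=
    PiTensorProduct.lift.tprod (φ := f) fun i => Additive.ofMul (a i)
  have hg' : (ℓ : ℤ) • g = 0 := by
    apply Submodule.linearMap_qext
    apply PiTensorProduct.ext
    ext a
    exact (congrArg ((ℓ : ℤ) • ·) (hg fun i => (a i).toMul)).trans (smul_zero _)
  refine ⟨(multiples (MilnorK R j) ℓ).liftQ g ?_, hg⟩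
  rintro _ ⟨x, rfl⟩
  exact (map_zsmul g _ _).trans (LinearMap.congr_fun hg' x)

end Symbols

/-! ### Milnor K-theory of a local algebra as a colimit -/

section Descent

variable {k : Type u} [CommRing k] {j ℓ : ℕ} {A : LocAlg k}

/-- The map on units induced by a morphism of local algebras. -/
abbrev LocAlg.Hom.units {R S : LocAlg k} (f : R ⟶ S) : R.carrierˣ →* S.carrierˣ :=
  Units.map ((LocAlg.Hom.hom f).toRingHom : R.carrier →* S.carrier)

/-- Finitely many units of a local algebra lift to an ind-smooth local algebra, universally. -/
theorem exists_universal_lift {σ : Type} [Finite σ] (a : σ → A.carrierˣ) :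
    ∃ (P : LocAlg k) (_ : indSmooth k P) (p : P ⟶ A) (y : σ → P.carrierˣ),
      (∀ t, LocAlg.Hom.units p (y t) = a t) ∧
      ∀ (R : LocAlg k) (s : R ⟶ A) (x : σ → R.carrierˣ), (∀ t, LocAlg.Hom.units s (x t) = a t) →
        ∃ f : P ⟶ R, f ≫ s = p ∧ ∀ t, LocAlg.Hom.units f (y t) = x t := by
  let v (t : ULift.{u} σ) : A.carrier := a t.down
  have hX (t) : IsUnit (freeLocal.X A v t) := by
    -- The coordinates need not be inverted by hand: the point is a local map sending them to units.
    refine (freeLocal.point A v).isLocalHom.map_nonunit _ ?_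
    exact (freeLocal.point_X A v t).symm ▸ (a t.down).isUnit
  refine ⟨freeLocal A v, freeLocal_indSmooth A v, freeLocal.point A v,
    fun t => (hX ⟨t⟩).unit, fun t => Units.ext (freeLocal.point_X A v ⟨t⟩), fun R s x hx => ?_⟩
  obtain ⟨f, hf⟩ := exists_freeLocal_hom v s (fun t => (x t.down : R.carrier))
    fun t => congrArg Units.val (hx t.down)
  refine ⟨f, freeLocal_hom_ext fun t => ?_, fun t => Units.ext (hf ⟨t⟩)⟩
  refine (congrArg s.hom (hf t)).trans ?_
  exact (congrArg Units.val (hx t.down)).trans (freeLocal.point_X A v t).symm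

/-- `K_j^M(A) / ℓ` is the colimit of the groups `K_j^M(R) / ℓ` over all `R ⟶ A` with `R`
ind-smooth: existence of the induced map. -/
theorem exists_milnorKMod_desc {M : Type*} [AddCommGroup M] [Module ℤ M]
    (φ : ∀ R : LocAlg k, indSmooth k R → (R ⟶ A) → (MilnorKMod R.carrier j ℓ →ₗ[ℤ] M))
    (hφ : ∀ (R S : LocAlg k) (hR : indSmooth k R) (hS : indSmooth k S) (f : R ⟶ S) (s : S ⟶ A) y,
      φ S hS s (MilnorKMod.map (LocAlg.Hom.hom f).toRingHom j ℓ y) = φ R hR (f ≫ s) y) :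
    ∃ ψ : MilnorKMod A.carrier j ℓ →ₗ[ℤ] M, ∀ (R : LocAlg k) (hR : indSmooth k R) (s : R ⟶ A) y,
      ψ (MilnorKMod.map (LocAlg.Hom.hom s).toRingHom j ℓ y) = φ R hR s y := by
  obtain rfl := Subsingleton.elim ‹Module ℤ M› (AddCommGroup.toIntModule M)
  -- Any lift of `a` receives a map over `A` from the universal one, so compatibility forces a
  -- common value.
  have H (a : Fin j → A.carrierˣ) : ∃ m : M, ∀ (R : LocAlg k) (hR : indSmooth k R) (s : R ⟶ A)
      (x : Fin j → R.carrierˣ), (∀ t, LocAlg.Hom.units s (x t) = a t) →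
        φ R hR s (symbol ℓ x) = m := by
    obtain ⟨P, hP, p, y, -, h⟩ := exists_universal_lift a
    refine ⟨φ P hP p (symbol ℓ y), fun R hR s x hx => ?_⟩
    obtain ⟨f, rfl, hf⟩ := h R s x hx
    rw [← hφ P R hP hR f s, map_symbol]
    exact congrArg (fun x => φ R hR s (symbol ℓ x)) (funext hf).symm
  choose Φ hΦ using H
  have hψ : ∃ ψ : MilnorKMod A.carrier j ℓ →ₗ[ℤ] M, ∀ a, ψ (symbol ℓ a) = Φ a := by
    refine exists_milnorKMod_lift Φ (fun a i b c => ?_) (fun a l m hlm h => ?_) (fun a => ?_)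
    -- Lifting `a`, `b` and `c` together puts all three symbols over one `P`, where the relation
    -- holds; `hΦ` accepts any lift, so each value of `Φ` may be computed there.
    · obtain ⟨P, hP, p, y, hy, -⟩ := exists_universal_lift (Sum.elim a ![b, c])
      have hu (e : P.carrierˣ) (d : A.carrierˣ) (hd : LocAlg.Hom.units p e = d) (t : Fin j) :
          LocAlg.Hom.units p (Function.update (fun t => y (Sum.inl t)) i e t) =
            Function.update a i d t := by
        by_cases ht : t = i
        · subst ht
          simpa using hd
        · simpa [ht] using hy (Sum.inl t)
      have hb : LocAlg.Hom.units p (y (Sum.inr 0)) = b := hy (Sum.inr 0)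
      have hc : LocAlg.Hom.units p (y (Sum.inr 1)) = c := hy (Sum.inr 1)
      rw [← hΦ _ P hP p _ (hu _ _ hb), ← hΦ _ P hP p _ (hu _ _ hc),
        ← hΦ _ P hP p _ (hu (y (Sum.inr 0) * y (Sum.inr 1)) (b * c) (by rw [map_mul, hb, hc])),
        symbol_update_mul, map_add]
    · obtain ⟨P, hP, p, y, hy, -⟩ := exists_universal_lift a
      have hl : p.hom (y l : P.carrier) = a l := congrArg Units.val (hy l)
      have hm : p.hom (1 - (y l : P.carrier)) = a m := by
        rw [map_sub, map_one, hl, ← h, add_sub_cancel_left]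
      -- The universal lift need not satisfy `y l + y m = 1`, so `y m` is replaced by `1 - y l`,
      -- which still lifts `a m`.
      have hunit : IsUnit (1 - (y l : P.carrier)) :=
        p.isLocalHom.map_nonunit _ (hm.symm ▸ (a m).isUnit)
      rw [← hΦ a P hP p (Function.update y m hunit.unit) fun t => ?_, symbol_eq_zero _ hlm, map_zero]
      · simp [hlm.ne]
      · by_cases ht : t = m
        · subst ht
          simpa using Units.ext hm
        · simpa [ht] using hy t
    · obtain ⟨P, hP, p, y, hy, -⟩ := exists_universal_lift a
      rw [← hΦ a P hP p y hy]
      exact ((φ P hP p).map_smul (ℓ : ℤ) (symbol ℓ y)).symm.trans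
        ((congrArg _ (smul_symbol y)).trans (map_zero _))
  obtain ⟨ψ, hψ⟩ := hψ
  refine ⟨ψ, fun R hR s y => ?_⟩
  refine LinearMap.congr_fun (f := ψ ∘ₗ MilnorKMod.map (LocAlg.Hom.hom s).toRingHom j ℓ)
    (milnorKMod_hom_ext fun x => ?_) y
  refine (congrArg ψ (map_symbol _ x)).trans ((hψ _).trans ?_)
  exact (hΦ _ R hR s x fun _ => rfl).symm

/-- `K_j^M(A) / ℓ` is the colimit of the groups `K_j^M(R) / ℓ` over all `R ⟶ A` with `R`
ind-smooth: uniqueness of the induced map. -/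
theorem milnorKMod_desc_unique {M : Type*} [AddCommGroup M] [Module ℤ M]
    {ψ ψ' : MilnorKMod A.carrier j ℓ →ₗ[ℤ] M}
    (h : ∀ (R : LocAlg k) (_ : indSmooth k R) (s : R ⟶ A) y,
      ψ (MilnorKMod.map (LocAlg.Hom.hom s).toRingHom j ℓ y) =
        ψ' (MilnorKMod.map (LocAlg.Hom.hom s).toRingHom j ℓ y)) : ψ = ψ' := by
  refine milnorKMod_hom_ext fun a => ?_
  obtain ⟨P, hP, p, y, hy, -⟩ := exists_universal_lift a
  have e : MilnorKMod.map (LocAlg.Hom.hom p).toRingHom j ℓ (symbol ℓ y) = symbol ℓ a :=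
    (map_symbol _ y).trans (congrArg (symbol ℓ) (funext hy))
  rw [← e]
  exact h P hP p _

end Descent

end MilnorLKE

/-! ### The main theorem -/

theorem proposition1p13 (k : Type u) [CommRing k] (j ℓ : ℕ)
    [HasDerivedCategory.{w} (ModuleCat.{u + 1} ℤ)]
    (A : Type u) [CommRing A] [Algebra k A] [IsLocalRing A] :
    IsIso (MilnorLKE.LsmCounitH₀ k j ℓ (MilnorLKE.LocAlg.of k A)) := by
  refine MilnorLKE.isIso_counitH₀_app (MilnorLKE.indSmooth k).ι (MilnorLKE.milnorKModLoc k j ℓ)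
    (MilnorLKE.LocAlg.of k A) (fun Z φ hφ => ?_) (fun Z ψ ψ' h => ?_)
  -- The coefficients are lifted to universe `u + 1`; `ULift.moduleEquiv` removes the lift so that
  -- the descent statements apply.
  · let φ' (R : MilnorLKE.LocAlg k) (hR : MilnorLKE.indSmooth k R)
        (s : R ⟶ MilnorLKE.LocAlg.of k A) : MilnorLKE.MilnorKMod R.carrier j ℓ →ₗ[ℤ] Z :=
      (φ ⟨R, hR⟩ s).hom ∘ₗ ULift.moduleEquiv.symm.toLinearMap
    obtain ⟨ψ, hψ⟩ := MilnorLKE.exists_milnorKMod_desc (M := Z) φ' fun R S hR hS f s y =>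
      LinearMap.congr_fun (congrArg ModuleCat.Hom.hom
        (hφ ⟨R, hR⟩ ⟨S, hS⟩ (ObjectProperty.homMk f) s)) (ULift.up y)
    refine ⟨ModuleCat.ofHom (ψ ∘ₗ
      (ULift.moduleEquiv : ULift.{u + 1} (MilnorLKE.MilnorKMod A j ℓ) ≃ₗ[ℤ] _).toLinearMap), fun c s => ?_⟩
    exact ModuleCat.hom_ext (LinearMap.ext fun y => hψ c.obj c.property s y.down)
  · let χ : MilnorLKE.MilnorKMod A j ℓ →ₗ[ℤ] Z := ψ.hom ∘ₗ ULift.moduleEquiv.symm.toLinearMap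
    let χ' : MilnorLKE.MilnorKMod A j ℓ →ₗ[ℤ] Z := ψ'.hom ∘ₗ ULift.moduleEquiv.symm.toLinearMap
    have e : χ = χ' :=
      MilnorLKE.milnorKMod_desc_unique (A := MilnorLKE.LocAlg.of k A) (M := Z) fun R hR s y =>
        LinearMap.congr_fun (congrArg ModuleCat.Hom.hom (h ⟨R, hR⟩ s)) (ULift.up y)
    exact ModuleCat.hom_ext (LinearMap.ext fun y => LinearMap.congr_fun e y.down)
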